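/- (1) Let $H$ be a complex Hilbert space (of any dimension) and $T\colon H\to H$ a bounded linear operator. Then there are $\alpha_1,\dots,\alpha_4\in\mathbb{C}$ and unitary operators $U_1,\dots,U_4$ on $H$ with $T=\sum_{k=1}^4\alpha_kU_k$. (2) Let $H$ be an infinite-dimensional real Hilbert space (not necessarily separable) and $T\colon H\to H$ a bounded linear operator. Then there are $N\in\mathbb{N}$, $\alpha_1,\dots,\alpha_N\in\mathbb{R}$ and orthogonal operators $U_1,\dots,U_N$ on $H$ (that is, $U_k^*U_k=U_kU_k^*=1$) with $T=\sum_{k=1}^N\alpha_kU_k$. (3) Let $H$ be an infinite-dimensional quaternionic Hilbert space, i.e. a right $\mathbb{H}$-module with an $\mathbb{H}$-valued Hermitian positive definite form $\langle\cdot,\cdot\rangle$, with $\langle xq,y\rangle=\langle x,y\rangle q$ for $q\in\mathbb{H}$, that is complete for the norm $\|x\|=\langle x,x\rangle^{1/2}$; and let $T\colon H\to H$ be a bounded $\mathbb{H}$-linear operator. Then there are $N\in\mathbb{N}$, $\alpha_1,\dots,\alpha_N\in\mathbb{R}$ and unitary $\mathbb{H}$-linear operators $U_1,\dots,U_N$ on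 $H$ (that is, $U_k$ has an adjoint $U_k^*$ with $U_k^*U_k=U_kU_k^*=1$) with $T=\sum_{k=1}^N\alpha_kU_k$. -/

import Mathlib

/-- A quaternionic inner product on a right module `E` over the quaternions. A right module over
`ℍ` is a module over the opposite ring `ℍᵐᵒᵖ`, and `x · q` is written `MulOpposite.op q • x`.
The form is right linear in its first argument, Hermitian, and induces the norm of `E`
(so it is positive definite). If `E` is complete, it is a quaternionic Hilbert space. -/
class QuaternionicInnerProductSpace (E : Type*) [NormedAddCommGroup E]
    [Module (Quaternion ℝ)ᵐᵒᵖ E] where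
  /-- The quaternion-valued inner product. -/
  qinner : E → E → Quaternion ℝ
  qinner_add_left : ∀ x y z : E, qinner (x + y) z = qinner x z + qinner y z
  qinner_smul_left : ∀ (q : Quaternion ℝ) (x y : E),
    qinner (MulOpposite.op q • x) y = qinner x y * q
  star_qinner : ∀ x y : E, star (qinner x y) = qinner y x
  qinner_self : ∀ x : E, qinner x x = ((‖x‖ ^ 2 : ℝ) : Quaternion ℝ)

/-- A bounded `ℍ`-linear operator `U` is unitary if it has a (bounded, `ℍ`-linear) adjoint `V`,
that is `⟨U x, y⟩ = ⟨x, V y⟩` for all `x, y`, and `V U = 1 = U V`. -/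
def IsQuaternionicUnitary {E : Type*} [NormedAddCommGroup E] [Module (Quaternion ℝ)ᵐᵒᵖ E]
    [QuaternionicInnerProductSpace E] (U : E →L[(Quaternion ℝ)ᵐᵒᵖ] E) : Prop :=
  ∃ V : E →L[(Quaternion ℝ)ᵐᵒᵖ] E,
    (∀ x y : E, QuaternionicInnerProductSpace.qinner (U x) y =
      QuaternionicInnerProductSpace.qinner x (V y)) ∧
    V.comp U = ContinuousLinearMap.id (Quaternion ℝ)ᵐᵒᵖ E ∧
    U.comp V = ContinuousLinearMap.id (Quaternion ℝ)ᵐᵒᵖ E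

/-!
A complex Hilbert space has the C⋆-algebra of its bounded operators, where Mathlib provides the
decomposition into four unitaries. The other two cases are instances of one fact about a complete
normed ⋆-algebra `A` over `ℝ`, `span_unitary_eq_top_of_cuntz`: if `A` contains `v`, `w` with
`v⋆v = w⋆w = 1` and `vv⋆ + ww⋆ = 1`, then `A` is the real linear span of its unitaries.

Such a pair identifies `A` with the `2 × 2` matrices over `A`, the matrix `(x i j)` standing for
`∑ V i * x i j * (V j)⋆` with `V = (v, w)`. For small `a`, the Halmos matrix
`[[a, √(1 - aa⋆)], [√(1 - a⋆a), -a⋆]]` is unitary. The span of the unitaries is a subalgebra, it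
contains `diag(1, -1)`, hence the projection `diag(1, 0)`, and cutting the Halmos matrix down by this
projection shows that it contains `diag(a, 0)`. Multiplying by the flip of the two coordinates moves
`a` to the other three places. As only small `a` matter, no functional calculus is needed: the
square roots come from the inverse function theorem at `1`
(`eventually_exists_mul_self_eq`), and their being selfadjoint and intertwined by `a` follows from
the injectivity of `y ↦ q * y + y * p` for `p`, `q` close to `1`
(`eq_zero_of_mul_add_mul_eq_zero`).

The isometries `v`, `w` come from an infinite Hilbert sum of copies of one space `G`, by splitting
the index set into two copies of itself (`IsHilbertSum.exists_cuntz`); here `G = ℝ` for a real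
Hilbert space. A quaternionic Hilbert space is a real one for the real part of its form, and its
quaternion linear operators form the commutant of the right multiplications, a closed
⋆-subalgebra. A maximal quaternionic orthonormal set exhibits the space as a Hilbert sum of copies of
`G = ℍ`, on which right multiplication acts coordinatewise, so that `v` and `w` lie in this
commutant.
-/

/-! ### Square roots near one -/

section SquareRoot

open Filter Topology

variable {A : Type*} [NormedRing A] [NormedAlgebra ℝ A]

/-- Squaring has the invertible derivative `y ↦ y + y` at `1`, so it maps neighbourhoods of `1` onto
neighbourhoods of `1`. -/
theorem eventually_exists_mul_self_eq [CompleteSpace A] {ε : ℝ} (hε : 0 < ε) :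
    ∀ᶠ x in 𝓝 (1 : A), ∃ p : A, ‖p - 1‖ < ε ∧ p * p = x := by
  have hd := (hasStrictFDerivAt_id (𝕜 := ℝ) (1 : A)).mul' (hasStrictFDerivAt_id (𝕜 := ℝ) (1 : A))
  have hsurj := hd.map_nhds_eq_of_surj (by
    refine LinearMap.range_eq_top.mpr fun y => ⟨(2 : ℝ)⁻¹ • y, ?_⟩
    simp [← add_smul]
    norm_num)
  have hball : ∀ᶠ p in 𝓝 (1 : A), ‖p - 1‖ < ε := by
    filter_upwards [Metric.ball_mem_nhds (1 : A) hε] with p hp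
    simpa [dist_eq_norm] using hp
  have himage := image_mem_map (m := (id * id : A → A)) hball
  rw [hsurj] at himage
  simp only [Pi.mul_apply, id, mul_one] at himage
  filter_upwards [himage] with x hx
  exact hx

/-- The Sylvester operator `y ↦ q * y + y * p` is injective for `p`, `q` close to `1`, being a
perturbation of `2 • y` of norm less than `2`. It serves as a uniqueness statement for square roots. -/
theorem eq_zero_of_mul_add_mul_eq_zero {p q y : A} (hp : ‖p - 1‖ < 1 / 2) (hq : ‖q - 1‖ < 1 / 2)
    (h : q * y + y * p = 0) : y = 0 := by
  have key : (2 : ℝ) • y = -((q - 1) * y + y * (p - 1)) := by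
    rw [sub_mul, mul_sub, one_mul, mul_one, eq_neg_iff_add_eq_zero, two_smul, ← h]
    abel
  have hn : 2 * ‖y‖ ≤ ‖q - 1‖ * ‖y‖ + ‖y‖ * ‖p - 1‖ := by
    calc 2 * ‖y‖ = ‖(2 : ℝ) • y‖ := by simp [norm_smul]
      _ ≤ ‖(q - 1) * y‖ + ‖y * (p - 1)‖ := by rw [key, norm_neg]; exact norm_add_le _ _
      _ ≤ _ := add_le_add (norm_mul_le _ _) (norm_mul_le _ _)
  by_contra hy
  have := norm_pos_iff.mpr hy
  nlinarith

variable [StarRing A] [NormedStarGroup A]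

theorem eq_star_of_mul_self {p b : A} (hp : ‖p - 1‖ < 1 / 2) (hb : star b = b)
    (h : p * p = b) : star p = p := by
  have hp' : ‖star p - 1‖ < 1 / 2 := by
    rw [← norm_star (star p - 1)]; simpa using hp
  have hs : star p * star p = b := by rw [← star_mul, h, hb]
  refine (sub_eq_zero.mp (eq_zero_of_mul_add_mul_eq_zero hp' hp ?_)).symm
  rw [mul_sub, sub_mul, h, hs]
  abel

/-- For `a` near `0` there are selfadjoint square roots `p` of `1 - a⋆a` and `q` of `1 - aa⋆`, and
`a` intertwines them. This is what the unitarity of the Halmos matrix of `a` requires. -/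
theorem eventually_exists_halmos [CompleteSpace A] :
    ∀ᶠ a in 𝓝 (0 : A), ∃ p q : A, star p = p ∧ star q = q ∧ p * p = 1 - star a * a ∧
      q * q = 1 - a * star a ∧ a * p = q * a := by
  have h1 : Tendsto (fun a : A => 1 - star a * a) (𝓝 0) (𝓝 1) :=
    Continuous.tendsto' (by fun_prop) _ _ (by simp)
  have h2 : Tendsto (fun a : A => 1 - a * star a) (𝓝 0) (𝓝 1) :=
    Continuous.tendsto' (by fun_prop) _ _ (by simp)
  have hs := eventually_exists_mul_self_eq (A := A) (ε := 1 / 2) (by norm_num)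
  filter_upwards [h1.eventually hs, h2.eventually hs] with a ⟨p, hp, hpp⟩ ⟨q, hq, hqq⟩
  refine ⟨p, q, eq_star_of_mul_self hp (by simp) hpp, eq_star_of_mul_self hq (by simp) hqq,
    hpp, hqq, sub_eq_zero.mp (eq_zero_of_mul_add_mul_eq_zero hp hq ?_)⟩
  calc q * (a * p - q * a) + (a * p - q * a) * p = a * (p * p) - q * q * a := by noncomm_ring
    _ = 0 := by rw [hpp, hqq]; noncomm_ring

end SquareRoot

/-! ### Normed ⋆-algebras containing a Cuntz pair of isometries -/

section Cuntz

open Filter Topology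

theorem star_mul_eq_zero_of_cuntz {A : Type*} [Ring A] [StarRing A] {v w : A}
    (hv : star v * v = 1) (hw : star w * w = 1) (hvw : v * star v + w * star w = 1) :
    star v * w = 0 := by
  have h : star v * (v * star v + w * star w) * w = star v * w + star v * w := by
    rw [mul_add, add_mul, ← mul_assoc, hv, one_mul, mul_assoc (star v), mul_assoc w, hw, mul_one]
  rw [hvw, mul_one] at h
  exact left_eq_add.mp h

/-- The Halmos matrix `[[a, q], [p, -a⋆]]` of `a`, written in the matrix units of the pair `v`, `w`,
is unitary. -/
theorem halmos_mem_unitary {A : Type*} [Ring A] [StarRing A] {v w a p q : A}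
    (hv : star v * v = 1) (hw : star w * w = 1) (hvw : v * star v + w * star w = 1)
    (hp : star p = p) (hq : star q = q) (hpp : p * p = 1 - star a * a)
    (hqq : q * q = 1 - a * star a) (hpq : a * p = q * a) :
    v * a * star v + v * q * star w + w * p * star v - w * star a * star w ∈ unitary A := by
  have h0 := star_mul_eq_zero_of_cuntz hv hw hvw
  have h0' : star w * v = 0 := by simpa using congrArg star h0
  have hpq' : p * star a = star a * q := by simpa [hp, hq] using congrArg star hpq
  have e1 (x : A) : star v * (v * x) = x := by rw [← mul_assoc, hv, one_mul]
  have e2 (x : A) : star w * (w * x) = x := by rw [← mul_assoc, hw, one_mul]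
  have e3 (x : A) : star v * (w * x) = 0 := by rw [← mul_assoc, h0, zero_mul]
  have e4 (x : A) : star w * (v * x) = 0 := by rw [← mul_assoc, h0', zero_mul]
  have e5 (x : A) : p * (p * x) = x - star a * (a * x) := by
    rw [← mul_assoc, hpp, sub_mul, one_mul, mul_assoc]
  have e6 (x : A) : q * (q * x) = x - a * (star a * x) := by
    rw [← mul_assoc, hqq, sub_mul, one_mul, mul_assoc]
  have e7 (x : A) : a * (p * x) = q * (a * x) := by rw [← mul_assoc, hpq, mul_assoc]
  have e8 (x : A) : p * (star a * x) = star a * (q * x) := by rw [← mul_assoc, hpq', mul_assoc]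
  rw [Unitary.mem_iff]
  constructor <;> rw [← hvw] <;>
    simp only [star_add, star_sub, star_mul, star_star, hp, hq, mul_add, add_mul, mul_sub, sub_mul,
      mul_assoc, e1, e2, e3, e4, e5, e6, e7, e8, mul_zero] <;>
    abel

variable {A : Type*} [NormedRing A] [NormedAlgebra ℝ A] [StarRing A]

/-- A complete normed ⋆-algebra over `ℝ` that contains isometries `v`, `w` with complementary
ranges is the real linear span of its unitaries. The C⋆-identity is not assumed. -/
theorem span_unitary_eq_top_of_cuntz [CompleteSpace A] [NormedStarGroup A] [StarModule ℝ A]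
    {v w : A} (hv : star v * v = 1) (hw : star w * w = 1) (hvw : v * star v + w * star w = 1) :
    Submodule.span ℝ (unitary A : Set A) = ⊤ := by
  have h0 := star_mul_eq_zero_of_cuntz hv hw hvw
  have h0' : star w * v = 0 := by simpa using congrArg star h0
  have e1 (x : A) : star v * (v * x) = x := by rw [← mul_assoc, hv, one_mul]
  have e2 (x : A) : star w * (w * x) = x := by rw [← mul_assoc, hw, one_mul]
  have e3 (x : A) : star v * (w * x) = 0 := by rw [← mul_assoc, h0, zero_mul]
  have e4 (x : A) : star w * (v * x) = 0 := by rw [← mul_assoc, h0', zero_mul]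
  have hspan := Algebra.adjoin_eq_span (R := ℝ) (unitary A : Set A)
  rw [Submonoid.closure_eq] at hspan
  rw [← hspan, Algebra.toSubmodule_eq_top]
  set S := Algebra.adjoin ℝ (unitary A : Set A)
  have hU {u : A} (hu : u ∈ unitary A) : u ∈ S := Algebra.subset_adjoin hu
  -- The matrices `diag(1, -1)`, `[[0, 1], [1, 0]]` and `diag(1, 0)` lie in `S`.
  have hD : v * star v - w * star w ∈ S := hU <| by
    rw [Unitary.mem_iff]
    constructor <;> rw [← hvw] <;>
      simp [mul_sub, sub_mul, mul_assoc, e1, e2, e3, e4]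
  have hs : v * star w + w * star v ∈ S := hU <| by
    rw [Unitary.mem_iff]
    constructor <;> rw [← hvw] <;>
      simp [mul_add, add_mul, mul_assoc, e1, e2, e3, e4, add_comm]
  have hP : v * star v ∈ S := by
    have : v * star v = (2 : ℝ)⁻¹ • (1 + (v * star v - w * star w)) := by
      rw [← hvw, eq_inv_smul_iff₀ two_ne_zero, two_smul]
      abel
    rw [this]
    exact S.smul_mem (S.add_mem S.one_mem hD) _
  -- A nonzero multiple `c • a` is small enough to have a Halmos matrix, and `diag(c • a, 0)` is the
  -- compression of that matrix by `diag(1, 0)`.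
  have hcorner (a : A) : v * a * star v ∈ S := by
    have hlim : Tendsto (fun c : ℝ => c • a) (𝓝[≠] 0) (𝓝 0) :=
      (Continuous.tendsto' (by fun_prop) _ _ (by simp)).mono_left nhdsWithin_le_nhds
    obtain ⟨c, ⟨p, q, hp, hq, hpp, hqq, hpq⟩, hc⟩ :=
      ((hlim.eventually eventually_exists_halmos).and self_mem_nhdsWithin).exists
    have hmem := S.mul_mem (S.mul_mem hP
      (hU (halmos_mem_unitary hv hw hvw hp hq hpp hqq hpq))) hP
    have heq : v * a * star v = c⁻¹ • (v * star v * (v * (c • a) * star v + v * q * star w +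
        w * p * star v - w * star (c • a) * star w) * (v * star v)) := by
      rw [eq_inv_smul_iff₀ hc]
      simp [mul_add, add_mul, mul_sub, mul_assoc, e1, e3, e4]
    rw [heq]
    exact S.smul_mem hmem _
  rw [eq_top_iff]
  intro x _
  -- The matrix of `x` has the four entries `v⋆xv`, `v⋆xw`, `w⋆xv`, `w⋆xw`. Each is placed in the
  -- upper left corner and moved to its position by the flip.
  have hx : x = v * (star v * x * v) * star v +
      v * (star v * x * w) * star v * (v * star w + w * star v) +
      (v * star w + w * star v) * (v * (star w * x * v) * star v) +
      (v * star w + w * star v) * (v * (star w * x * w) * star v) *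
        (v * star w + w * star v) := by
    calc x = (v * star v + w * star w) * x * (v * star v + w * star w) := by
          rw [hvw, one_mul, mul_one]
      _ = _ := by
          simp only [mul_add, add_mul, mul_assoc, e1, e3, e4, mul_zero, add_zero, zero_add]
          abel
  rw [hx]
  exact S.add_mem (S.add_mem (S.add_mem (hcorner _) (S.mul_mem (hcorner _) hs))
    (S.mul_mem hs (hcorner _))) (S.mul_mem (S.mul_mem hs (hcorner _)) hs)

end Cuntz

/-! ### Isometries of an infinite Hilbert sum of copies of one space -/

section HilbertSum

variable {ι H G : Type*} [NormedAddCommGroup H] [InnerProductSpace ℝ H] [CompleteSpace H]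
  [NormedAddCommGroup G] [InnerProductSpace ℝ G] {V : ι → G →ₗᵢ[ℝ] H}

theorem IsHilbertSum.finiteDimensional [Finite ι] [FiniteDimensional ℝ G]
    (hV : IsHilbertSum ℝ (fun _ : ι => G) V) : FiniteDimensional ℝ H := by
  let φ : H →ₗ[ℝ] (ι → G) :=
    { toFun := fun x => hV.linearIsometryEquiv x
      map_add' := fun x y => by simp; rfl
      map_smul' := fun c x => by simp }
  refine FiniteDimensional.of_injective φ fun x y hxy => hV.linearIsometryEquiv.injective ?_
  exact lp.ext hxy

theorem IsHilbertSum.continuousLinearMap_ext {F : Type*} [NormedAddCommGroup F] [NormedSpace ℝ F]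
    (hV : IsHilbertSum ℝ (fun _ : ι => G) V) {S T : H →L[ℝ] F}
    (h : ∀ i x, S (V i x) = T (V i x)) : S = T := by
  ext x
  have hx := hV.hasSum_linearIsometryEquiv_symm (hV.linearIsometryEquiv x)
  rw [LinearIsometryEquiv.symm_apply_apply] at hx
  refine (S.hasSum hx).unique ?_
  simpa only [h] using T.hasSum hx

/-- An injection of the index set induces an isometry that carries the summand `i` onto the
summand `f i`. -/
theorem IsHilbertSum.exists_reindex (hV : IsHilbertSum ℝ (fun _ : ι => G) V) {f : ι → ι}
    (hf : Function.Injective f) :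
    ∃ F : H →L[ℝ] H, star F * F = 1 ∧ ∀ i x, F (V i x) = V (f i) x := by
  classical
  let L : H →ₗᵢ[ℝ] H := (hV.OrthogonalFamily.comp hf).linearIsometry.comp
    hV.linearIsometryEquiv.toLinearIsometry
  refine ⟨L.toContinuousLinearMap, ?_, fun i x => ?_⟩
  · rw [ContinuousLinearMap.star_eq_adjoint]
    exact (ContinuousLinearMap.norm_map_iff_adjoint_comp_self _).mp L.norm_map
  · have h : hV.linearIsometryEquiv (V i x) = lp.single 2 i x := by
      rw [← hV.linearIsometryEquiv_symm_apply_single, LinearIsometryEquiv.apply_symm_apply]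
    simp [L, h, OrthogonalFamily.linearIsometry_apply_single]

/-- An infinite Hilbert sum of copies of `G` carries isometries `v`, `w` with complementary ranges.
They map copies identically onto copies, so they commute with every operator that acts by one and the same map
`r` on each copy. -/
theorem IsHilbertSum.exists_cuntz [Infinite ι] (hV : IsHilbertSum ℝ (fun _ : ι => G) V) :
    ∃ v w : H →L[ℝ] H, star v * v = 1 ∧ star w * w = 1 ∧ v * star v + w * star w = 1 ∧
      ∀ (R : H →L[ℝ] H) (r : G → G), (∀ i x, R (V i x) = V i (r x)) →
        R * v = v * R ∧ R * w = w * R := by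
  obtain ⟨e⟩ : Nonempty (ι ⊕ ι ≃ ι) := by
    rw [← Cardinal.eq, ← Cardinal.add_def]
    exact Cardinal.add_eq_self (Cardinal.aleph0_le_mk ι)
  obtain ⟨v, hv, hvV⟩ := hV.exists_reindex (e.injective.comp Sum.inl_injective)
  obtain ⟨w, hw, hwV⟩ := hV.exists_reindex (e.injective.comp Sum.inr_injective)
  simp only [Function.comp_apply] at hvV hwV
  -- `v` and `w` map every summand into different summands.
  have horth : star v * w = 0 := by
    refine hV.continuousLinearMap_ext fun i x => ext_inner_left ℝ fun y => ?_
    have hzero : innerSL ℝ (w (V i x)) ∘L v = 0 := hV.continuousLinearMap_ext fun j z => by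
      simpa [hvV, hwV] using hV.OrthogonalFamily (i := e (Sum.inr i)) (j := e (Sum.inl j))
        (by simp) x z
    have := DFunLike.congr_fun hzero y
    simp only [ContinuousLinearMap.comp_apply, innerSL_apply_apply] at this
    simpa [ContinuousLinearMap.star_eq_adjoint, ContinuousLinearMap.adjoint_inner_right,
      real_inner_comm] using this
  have horth' : star w * v = 0 := by simpa using congrArg star horth
  refine ⟨v, w, hv, hw, hV.continuousLinearMap_ext fun i x => ?_, fun R r hR => ?_⟩
  · have ev (y : H) : star v (v y) = y := DFunLike.congr_fun hv y
    have ew (y : H) : star w (w y) = y := DFunLike.congr_fun hw y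
    have evw (y : H) : star v (w y) = 0 := DFunLike.congr_fun horth y
    have ewv (y : H) : star w (v y) = 0 := DFunLike.congr_fun horth' y
    obtain ⟨j | j, rfl⟩ := e.surjective i
    · simp [← hvV, ev, ewv]
    · simp [← hwV, ew, evw]
  · constructor <;> refine hV.continuousLinearMap_ext fun i x => ?_ <;> simp [hvV, hwV, hR]

end HilbertSum

/-! ### Real Hilbert spaces -/

theorem exists_fin_sum_of_span_unitary_eq_top {A : Type*} [Semiring A] [StarMul A] [Module ℝ A]
    (h : Submodule.span ℝ (unitary A : Set A) = ⊤) (x : A) :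
    ∃ (N : ℕ) (α : Fin N → ℝ) (U : Fin N → A), (∀ k, U k ∈ unitary A) ∧ x = ∑ k, α k • U k := by
  obtain ⟨N, α, U, hU⟩ := Submodule.mem_span_set'.mp (h ▸ Submodule.mem_top (x := x))
  exact ⟨N, α, fun k => U k, fun k => (U k).2, hU.symm⟩

theorem exists_sum_unitary_real {H : Type*} [NormedAddCommGroup H] [InnerProductSpace ℝ H]
    [CompleteSpace H] (hH : ¬ FiniteDimensional ℝ H) (T : H →L[ℝ] H) :
    ∃ (N : ℕ) (α : Fin N → ℝ) (U : Fin N → H →L[ℝ] H),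
      (∀ k, U k ∈ unitary (H →L[ℝ] H)) ∧ T = ∑ k, α k • U k := by
  obtain ⟨s, b, -⟩ := exists_hilbertBasis ℝ H
  have hV := b.orthonormal.isHilbertSum b.dense_span.ge
  have : Infinite s := not_finite_iff_infinite.mp fun _ => hH hV.finiteDimensional
  obtain ⟨v, w, hv, hw, hvw, -⟩ := hV.exists_cuntz
  exact exists_fin_sum_of_span_unitary_eq_top (span_unitary_eq_top_of_cuntz hv hw hvw) T

/-! ### Quaternionic Hilbert spaces -/

namespace QuaternionicInnerProductSpace

open MulOpposite
open scoped Quaternion InnerProductSpace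

variable {H : Type*} [NormedAddCommGroup H] [Module ℍ[ℝ]ᵐᵒᵖ H] [QuaternionicInnerProductSpace H]

theorem qinner_smul_right (q : ℍ[ℝ]) (x y : H) : qinner x (op q • y) = star q * qinner x y := by
  rw [← star_qinner, qinner_smul_left, star_mul, star_qinner]

theorem norm_op_smul (q : ℍ[ℝ]) (x : H) : ‖op q • x‖ = ‖q‖ * ‖x‖ := by
  have h := qinner_self (op q • x)
  rw [qinner_smul_left, qinner_smul_right, qinner_self, mul_assoc,
    (Quaternion.coe_commutes _ _), ← mul_assoc, Quaternion.star_mul_self, ← Quaternion.coe_mul,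
    Quaternion.coe_inj, Quaternion.normSq_eq_norm_mul_self] at h
  refine (pow_left_inj₀ (norm_nonneg _) (by positivity) two_ne_zero).mp ?_
  rw [← h]
  ring

variable (H) in
/-- The real inner product space underlying a quaternionic one: the scalars are restricted along
`ℝ → ℍᵐᵒᵖ` and the inner product is the real part of the quaternionic form. The norm is unchanged. -/
@[reducible]
noncomputable def realInnerProductSpace : InnerProductSpace ℝ H where
  toModule := Module.compHom H (algebraMap ℝ ℍ[ℝ]ᵐᵒᵖ)
  norm_smul_le c x := by
    have h := norm_op_smul (c : ℍ[ℝ]) x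
    rw [Quaternion.norm_coe] at h
    exact h.le
  inner x y := (qinner x y).re
  norm_sq_eq_re_inner x := by
    rw [qinner_self, Quaternion.re_coe, RCLike.re_to_real]
  conj_inner_symm x y := by simp [← star_qinner x y]
  add_left x y z := by simp [qinner_add_left]
  smul_left x y c := by
    have h := qinner_smul_left (c : ℍ[ℝ]) x y
    refine (congrArg QuaternionAlgebra.re h).trans ?_
    rw [← Quaternion.coe_commutes]
    simp

attribute [local instance] realInnerProductSpace

theorem real_inner_eq (x y : H) : ⟪x, y⟫_ℝ = (qinner x y).re := rfl

theorem real_smul_eq (c : ℝ) (x : H) : c • x = op (c : ℍ[ℝ]) • x := rfl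

theorem isScalarTower_real : IsScalarTower ℝ ℍ[ℝ]ᵐᵒᵖ H :=
  IsScalarTower.of_algebraMap_smul fun _ _ => rfl

theorem re_mul_comm (a b : ℍ[ℝ]) : (a * b).re = (b * a).re := by
  simp only [Quaternion.re_mul]
  ring

theorem eq_zero_of_re_mul_eq_zero {z : ℍ[ℝ]} (h : ∀ q : ℍ[ℝ], (z * q).re = 0) : z = 0 := by
  have := h (star z)
  rwa [Quaternion.self_mul_star, Quaternion.re_coe, Quaternion.normSq_eq_zero] at this

theorem real_inner_op_smul_left (q : ℍ[ℝ]) (x y : H) :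
    ⟪op q • x, y⟫_ℝ = (qinner x y * q).re := by
  rw [real_inner_eq, qinner_smul_left]

/-- The quaternionic form is determined by its real part: `x` and `y` are orthogonal if and only if
`y` is orthogonal, in the real sense, to the quaternionic line through `x`. -/
theorem qinner_eq_zero_iff {x y : H} : qinner x y = 0 ↔ ∀ q : ℍ[ℝ], ⟪op q • x, y⟫_ℝ = 0 := by
  simp only [real_inner_op_smul_left]
  exact ⟨fun h q => by simp [h], eq_zero_of_re_mul_eq_zero⟩

variable (H) in
/-- Right multiplication by a quaternion, as a bounded real linear operator. It is not quaternion
linear in general. -/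
noncomputable def rightMul (q : ℍ[ℝ]) : H →L[ℝ] H :=
  LinearMap.mkContinuous
    { toFun := fun x => op q • x
      map_add' := fun x y => smul_add _ x y
      map_smul' := fun c x => by
        simp only [real_smul_eq, smul_smul, RingHom.id_apply, ← op_mul, Quaternion.coe_commutes] }
    ‖q‖ fun x => (norm_op_smul q x).le

@[simp]
theorem rightMul_apply (q : ℍ[ℝ]) (x : H) : rightMul H q x = op q • x := rfl

variable [CompleteSpace H]

theorem star_rightMul (q : ℍ[ℝ]) : star (rightMul H q) = rightMul H (star q) := by
  rw [ContinuousLinearMap.star_eq_adjoint, eq_comm, ContinuousLinearMap.eq_adjoint_iff]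
  intro x y
  rw [rightMul_apply, rightMul_apply, real_inner_op_smul_left, real_inner_eq, qinner_smul_right,
    re_mul_comm]

variable (H) in
/-- The bounded quaternion linear operators, as the commutant of the right multiplications in the
algebra of bounded real linear operators. -/
noncomputable def linearOperators : StarSubalgebra ℝ (H →L[ℝ] H) :=
  StarSubalgebra.centralizer ℝ (Set.range (rightMul H))

theorem mem_linearOperators_iff {a : H →L[ℝ] H} :
    a ∈ linearOperators H ↔ ∀ (q : ℍ[ℝ]) (x : H), a (op q • x) = op q • a x := by
  rw [linearOperators, StarSubalgebra.mem_centralizer_iff, Set.forall_mem_range]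
  refine ⟨fun h q x => (DFunLike.congr_fun (h q).1 x).symm, fun h q => ⟨?_, ?_⟩⟩
  · ext x; exact (h q x).symm
  · rw [star_rightMul]; ext x; exact (h _ x).symm

theorem isClosed_linearOperators : IsClosed (linearOperators H : Set (H →L[ℝ] H)) :=
  Set.isClosed_centralizer _

/-- The real adjoint of a quaternion linear operator is its quaternionic adjoint. -/
theorem qinner_apply_eq {a : H →L[ℝ] H} (ha : a ∈ linearOperators H) (x y : H) :
    qinner (a x) y = qinner x (star a y) := by
  rw [← sub_eq_zero]
  refine eq_zero_of_re_mul_eq_zero fun q => ?_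
  rw [sub_mul, Quaternion.re_sub, sub_eq_zero, ← real_inner_op_smul_left,
    ← real_inner_op_smul_left, ← mem_linearOperators_iff.mp ha,
    ContinuousLinearMap.star_eq_adjoint, ContinuousLinearMap.adjoint_inner_right]

/-- An element of the commutant of the right multiplications, as a quaternion linear operator. -/
noncomputable def toQuaternionLinear (a : linearOperators H) : H →L[ℍ[ℝ]ᵐᵒᵖ] H where
  toFun := a.1
  map_add' := map_add a.1
  map_smul' q x := mem_linearOperators_iff.mp a.2 q.unop x
  cont := a.1.continuous

theorem isQuaternionicUnitary_toQuaternionLinear {a : linearOperators H}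
    (ha : a ∈ unitary (linearOperators H)) : IsQuaternionicUnitary (toQuaternionLinear a) := by
  refine ⟨toQuaternionLinear (star a), fun x y => qinner_apply_eq a.2 x y, ?_, ?_⟩
  · ext x; exact DFunLike.congr_fun (congrArg Subtype.val (Unitary.mem_iff.mp ha).1) x
  · ext x; exact DFunLike.congr_fun (congrArg Subtype.val (Unitary.mem_iff.mp ha).2) x

/-- The parametrization `q ↦ e q` of the quaternionic line through a unit vector `e`. -/
noncomputable def lineIsometry (e : H) (he : ‖e‖ = 1) : ℍ[ℝ] →ₗᵢ[ℝ] H where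
  toFun q := op q • e
  map_add' p q := by rw [op_add, add_smul]
  map_smul' c q := by
    rw [real_smul_eq, smul_smul, ← op_mul, RingHom.id_apply, ← Quaternion.coe_commutes,
      Quaternion.coe_mul_eq_smul]
  norm_map' q := by simp [norm_op_smul, he]

variable (H) in
/-- A quaternionic Hilbert space is the Hilbert sum of the quaternionic lines through the elements of
a maximal orthonormal set. -/
theorem exists_isHilbertSum : ∃ (s : Set H) (hs : ∀ e : s, ‖(e : H)‖ = 1),
    IsHilbertSum ℝ (fun _ : s => ℍ[ℝ]) fun e => lineIsometry (e : H) (hs e) := by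
  obtain ⟨s, hs⟩ := zorn_subset
    {s : Set H | (∀ e ∈ s, ‖e‖ = 1) ∧ s.Pairwise fun x y => qinner x y = 0} (by
      intro c hc hchain
      refine ⟨⋃₀ c, ⟨?_, ?_⟩, fun t ht => Set.subset_sUnion_of_mem ht⟩
      · rintro e ⟨t, ht, he⟩
        exact (hc ht).1 e he
      · exact (Set.pairwise_sUnion hchain.directedOn).mpr fun t ht => (hc ht).2)
  obtain ⟨hnorm, horth⟩ := hs.prop
  refine ⟨s, fun e => hnorm e e.2, IsHilbertSum.mk ?_ ?_⟩
  · intro i j hij x y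
    change ⟪op x • (i : H), op y • (j : H)⟫_ℝ = 0
    rw [real_inner_op_smul_left, qinner_smul_right, horth i.2 j.2 (Subtype.coe_injective.ne hij)]
    simp
  · rw [top_le_iff, Submodule.topologicalClosure_eq_top_iff, Submodule.eq_bot_iff]
    intro y hy
    have hy' : ∀ e ∈ s, qinner e y = 0 := fun e he => qinner_eq_zero_iff.mpr fun q =>
      (Submodule.mem_orthogonal _ _).mp hy _ <|
        Submodule.mem_iSup_of_mem (⟨e, he⟩ : s) ⟨q, rfl⟩
    by_contra hne
    -- A nonzero vector orthogonal to all lines could be normalized and added to `s`.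
    have hins : (‖y‖⁻¹ • y) ∈ s := by
      refine hs.mem_of_prop_insert ⟨?_, ?_⟩
      · rintro e (rfl | he)
        · exact norm_smul_inv_norm hne
        · exact hnorm e he
      · refine Set.pairwise_insert.mpr ⟨horth, fun e he _ => ?_⟩
        have h : qinner e (‖y‖⁻¹ • y) = 0 := by
          rw [real_smul_eq, qinner_smul_right, hy' e he, mul_zero]
        exact ⟨by rw [← star_qinner, h, star_zero], h⟩
    have hzero := real_inner_eq (‖y‖⁻¹ • y) y
    rw [hy' _ hins, real_inner_smul_left, real_inner_self_eq_norm_sq] at hzero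
    simp [hne] at hzero

theorem exists_sum_unitary (hH : ¬ Module.Finite ℍ[ℝ]ᵐᵒᵖ H) (T : H →L[ℍ[ℝ]ᵐᵒᵖ] H) :
    ∃ (N : ℕ) (α : Fin N → ℝ) (U : Fin N → H →L[ℍ[ℝ]ᵐᵒᵖ] H),
      (∀ k, IsQuaternionicUnitary (U k)) ∧
      ∀ x : H, T x = ∑ k, op ((α k : ℝ) : ℍ[ℝ]) • U k x := by
  obtain ⟨s, hs, hV⟩ := exists_isHilbertSum H
  have : Infinite s := not_finite_iff_infinite.mp fun _ => hH <| by
    have := hV.finiteDimensional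
    have := isScalarTower_real (H := H)
    exact Module.Finite.of_restrictScalars_finite ℝ ℍ[ℝ]ᵐᵒᵖ H
  obtain ⟨v, w, hv, hw, hvw, hcomm⟩ := hV.exists_cuntz
  -- On each line, right multiplication by `q` is `p ↦ p * q`, independently of the line.
  have hmem (q : ℍ[ℝ]) := hcomm (rightMul H q) (fun p => p * q) fun e p => by
    change op q • op p • (e : H) = op (p * q) • (e : H)
    rw [smul_smul, op_mul]
  have hvS : v ∈ linearOperators H := mem_linearOperators_iff.mpr fun q x =>
    (DFunLike.congr_fun (hmem q).1 x).symm
  have hwS : w ∈ linearOperators H := mem_linearOperators_iff.mpr fun q x =>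
    (DFunLike.congr_fun (hmem q).2 x).symm
  have : CompleteSpace (linearOperators H) := isClosed_linearOperators.completeSpace_coe
  have : NormedStarGroup (linearOperators H) := ⟨fun a => (norm_star (a : H →L[ℝ] H)).le⟩
  have hspan := span_unitary_eq_top_of_cuntz (A := linearOperators H) (v := ⟨v, hvS⟩)
    (w := ⟨w, hwS⟩) (Subtype.ext hv) (Subtype.ext hw) (Subtype.ext hvw)
  let T' : H →L[ℝ] H :=
    { toFun := T
      map_add' := map_add T
      map_smul' := fun c x => T.map_smul (op (c : ℍ[ℝ])) x
      cont := T.continuous }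
  obtain ⟨N, α, U, hU, hsum⟩ := exists_fin_sum_of_span_unitary_eq_top hspan
    ⟨T', mem_linearOperators_iff.mpr fun q x => T.map_smul (op q) x⟩
  refine ⟨N, α, fun k => toQuaternionLinear (U k),
    fun k => isQuaternionicUnitary_toQuaternionLinear (hU k), fun x => ?_⟩
  have h := DFunLike.congr_fun (congrArg Subtype.val hsum) x
  refine h.trans ?_
  simp [sum_apply]
  rfl

end QuaternionicInnerProductSpace

/-! ### The three kinds of Hilbert spaces -/

theorem mainTheorem8 :
    (∀ (H : Type*) [NormedAddCommGroup H] [InnerProductSpace ℂ H] [CompleteSpace H]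
      (T : H →L[ℂ] H),
      ∃ (α : Fin 4 → ℂ) (U : Fin 4 → H →L[ℂ] H),
        (∀ k, U k ∈ unitary (H →L[ℂ] H)) ∧ T = ∑ k, α k • U k) ∧
    (∀ (H : Type*) [NormedAddCommGroup H] [InnerProductSpace ℝ H] [CompleteSpace H],
      ¬ FiniteDimensional ℝ H → ∀ T : H →L[ℝ] H,
      ∃ (N : ℕ) (α : Fin N → ℝ) (U : Fin N → H →L[ℝ] H),
        (∀ k, U k ∈ unitary (H →L[ℝ] H)) ∧ T = ∑ k, α k • U k) ∧
    (∀ (H : Type*) [NormedAddCommGroup H] [Module (Quaternion ℝ)ᵐᵒᵖ H]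
      [QuaternionicInnerProductSpace H] [CompleteSpace H],
      ¬ Module.Finite (Quaternion ℝ)ᵐᵒᵖ H → ∀ T : H →L[(Quaternion ℝ)ᵐᵒᵖ] H,
      ∃ (N : ℕ) (α : Fin N → ℝ) (U : Fin N → H →L[(Quaternion ℝ)ᵐᵒᵖ] H),
        (∀ k, IsQuaternionicUnitary (U k)) ∧
        ∀ x : H, T x = ∑ k, MulOpposite.op ((α k : ℝ) : Quaternion ℝ) • U k x) := by
  refine ⟨fun H _ _ _ T => ?_, fun H _ _ _ hH T => exists_sum_unitary_real hH T,
    fun H _ _ _ _ hH T => QuaternionicInnerProductSpace.exists_sum_unitary hH T⟩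
  obtain ⟨u, α, hT, -⟩ := CStarAlgebra.exists_sum_four_unitary T
  exact ⟨α, fun k => u k, fun k => (u k).2, hT⟩
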